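/- Let $X$ be a (real or complex) Banach space with dual $X^*$. Let $\mathcal F(X)$ be the algebra of bounded finite-rank operators on $X$, $\mathcal A(X)$ the Banach algebra of approximable operators (the operator-norm closure of $\mathcal F(X)$), $\mathcal N(X)$ the set of nuclear operators on $X$ (operators $T$ of the form $Tx=\sum_{n}f_n(x)y_n$ with $f_n\in X^*$, $y_n\in X$, $\sum_n\|f_n\|\|y_n\|<\infty$), and $\mathcal I(X)$ the set of integral operators on $X$ (bounded operators $T$ for which the bilinear form $(x,f)\mapsto f(Tx)$ on $X\times X^*$ induces a bounded linear functional on $X\otimes X^*$ with the injective tensor norm). Let $\operatorname{tr}$ be the trace of finite-rank operators, and let $\mu\colon\mathcal A(X)\widehat\otimes\mathcal A(X)\to\mathcal A(X)$ be the bounded linear map on the projective tensor product with $\mu(A\otimes B)=AB$. Consider the conditions (i) $\mathcal A(X)=\mathcal N(X)$; (ii) $\mathcal A(X)\subseteq\mathcal I(X)$; (iii) there is $C>0$ such that $|\operatorname{tr}(AB)|\le C\|A\|\|B\|$ for all $A,B\in\mathcal F(X)$; (iv) $\mu$ maps onto $\mathcal N(X)$, i.e. the image of $\mu$ equals $\mathcal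 N(X)$. Then (i)$\Rightarrow$(ii)$\Leftrightarrow$(iii)$\Rightarrow$(iv). If, in addition, $\mu$ is surjective onto $\mathcal A(X)$, then (i), (ii), (iii) and (iv) are equivalent. -/

import Mathlib

open scoped TensorProduct

noncomputable section

namespace OperatorIdeals

section Operators

variable (𝕜 : Type*) [RCLike 𝕜]
variable (X : Type*) [NormedAddCommGroup X] [NormedSpace 𝕜 X]

/-- The algebra `ℱ(X)` of bounded finite-rank operators on `X`. -/
def finiteRank : NonUnitalSubalgebra 𝕜 (X →L[𝕜] X) where
  carrier := {T | FiniteDimensional 𝕜 (LinearMap.range T.toLinearMap)}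
  zero_mem' := by
    change FiniteDimensional 𝕜 (LinearMap.range (0 : X →ₗ[𝕜] X))
    rw [LinearMap.range_zero]
    infer_instance
  add_mem' := by
    intro S T hS hT
    simp only [Set.mem_ofPred_eq] at hS hT ⊢
    exact Submodule.finiteDimensional_of_le
      (S₂ := LinearMap.range S.toLinearMap ⊔ LinearMap.range T.toLinearMap)
      (LinearMap.range_add_le S.toLinearMap T.toLinearMap)
  mul_mem' := by
    intro S T hS _
    simp only [Set.mem_ofPred_eq] at hS ⊢
    exact Submodule.finiteDimensional_of_le (S₂ := LinearMap.range S.toLinearMap)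
      (LinearMap.range_comp_le_range T.toLinearMap S.toLinearMap)
  smul_mem' := by
    intro c T hT
    simp only [Set.mem_ofPred_eq] at hT ⊢
    refine Submodule.finiteDimensional_of_le (S₂ := LinearMap.range T.toLinearMap) ?_
    rintro _ ⟨x, rfl⟩
    exact ⟨c • x, by simp⟩

/-- The Banach algebra `𝒜(X)` of approximable operators on `X`: the closure of `ℱ(X)` in the
operator norm. -/
def approximable : NonUnitalSubalgebra 𝕜 (X →L[𝕜] X) :=
  (finiteRank 𝕜 X).topologicalClosure

instance : NormedSpace 𝕜 (approximable 𝕜 X) where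
  norm_smul_le c T := norm_smul_le c (T : X →L[𝕜] X)

instance [CompleteSpace X] : CompleteSpace (approximable 𝕜 X) :=
  (finiteRank 𝕜 X).isClosed_topologicalClosure.completeSpace_coe

variable {𝕜 X}

/-- The trace of a finite-rank operator `T`, i.e. the trace of the endomorphism that `T` induces
on its (finite-dimensional) range. -/
def finiteRankTrace (T : X →L[𝕜] X) : 𝕜 :=
  LinearMap.trace 𝕜 (LinearMap.range T.toLinearMap)
    (T.toLinearMap.restrict (p := LinearMap.range T.toLinearMap)
      (q := LinearMap.range T.toLinearMap) fun x _ => LinearMap.mem_range_self _ x)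

variable {Y : Type*} [NormedAddCommGroup Y] [NormedSpace 𝕜 Y]

/-- `T : X → Y` is nuclear if `T x = ∑ₙ fₙ(x) yₙ` for some `fₙ ∈ X*`, `yₙ ∈ Y` with
`∑ₙ ‖fₙ‖ ‖yₙ‖ < ∞`. -/
def IsNuclear (T : X →L[𝕜] Y) : Prop :=
  ∃ (f : ℕ → StrongDual 𝕜 X) (y : ℕ → Y),
    Summable (fun n => ‖f n‖ * ‖y n‖) ∧ ∀ x, HasSum (fun n => f n x • y n) (T x)

/-- The injective tensor norm of `u = ∑ xᵢ ⊗ yᵢ`: the supremum of `|∑ f(xᵢ) g(yᵢ)|` over `f`, `g`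
in the closed unit balls of `X*` and `Y*`. -/
def injectiveNorm (u : X ⊗[𝕜] Y) : ℝ :=
  ⨆ p : Metric.closedBall (0 : StrongDual 𝕜 X) 1 × Metric.closedBall (0 : StrongDual 𝕜 Y) 1,
    ‖TensorProduct.dualDistrib 𝕜 X Y
      ((p.1.1 : X →ₗ[𝕜] 𝕜) ⊗ₜ[𝕜] (p.2.1 : Y →ₗ[𝕜] 𝕜)) u‖

/-- The supremum defining the injective norm is finite. -/
theorem bddAbove_injectiveNorm (u : X ⊗[𝕜] Y) : BddAbove (Set.range
    fun p : Metric.closedBall (0 : StrongDual 𝕜 X) 1 × Metric.closedBall (0 : StrongDual 𝕜 Y) 1 =>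
      ‖TensorProduct.dualDistrib 𝕜 X Y
        ((p.1.1 : X →ₗ[𝕜] 𝕜) ⊗ₜ[𝕜] (p.2.1 : Y →ₗ[𝕜] 𝕜)) u‖) := by
  induction u with
  | zero => exact ⟨0, by rintro _ ⟨p, rfl⟩; simp⟩
  | tmul x y =>
    refine ⟨‖x‖ * ‖y‖, ?_⟩
    rintro _ ⟨⟨⟨f, hf⟩, ⟨g, hg⟩⟩, rfl⟩
    rw [mem_closedBall_zero_iff] at hf hg
    simp only [TensorProduct.dualDistrib_apply, ContinuousLinearMap.coe_coe, norm_mul]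
    exact mul_le_mul (f.le_of_opNorm_le_of_le hf le_rfl |>.trans (by simp))
      (g.le_of_opNorm_le_of_le hg le_rfl |>.trans (by simp)) (norm_nonneg _) (norm_nonneg _)
  | add u v hu hv =>
    obtain ⟨a, ha⟩ := hu
    obtain ⟨b, hb⟩ := hv
    refine ⟨a + b, ?_⟩
    rintro _ ⟨p, rfl⟩
    simp only [map_add]
    exact (norm_add_le _ _).trans (add_le_add (ha ⟨p, rfl⟩) (hb ⟨p, rfl⟩))

/-- The linear functional on `X ⊗ Y*` given by the bilinear form `(x, g) ↦ g (T x)`. -/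
def associatedForm (T : X →L[𝕜] Y) : X ⊗[𝕜] StrongDual 𝕜 Y →ₗ[𝕜] 𝕜 :=
  TensorProduct.lift
    (LinearMap.mk₂ 𝕜 (fun (x : X) (g : StrongDual 𝕜 Y) => g (T x))
      (by intros; simp) (by intros; simp) (by intros; simp) (by intros; simp))

/-- `T : X → Y` is (Grothendieck) integral if the bilinear form `(x, g) ↦ g (T x)` on `X × Y*`
defines a bounded linear functional for the injective tensor norm on `X ⊗ Y*`. -/
def IsIntegralOperator (T : X →L[𝕜] Y) : Prop :=
  ∃ C : ℝ, ∀ u : X ⊗[𝕜] StrongDual 𝕜 Y, ‖associatedForm T u‖ ≤ C * injectiveNorm u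

variable (𝕜 X)

/-- The set `𝒩(X)` of nuclear operators on `X`. -/
def nuclearOperators : Set (X →L[𝕜] X) := {T | IsNuclear T}

/-- The set `ℐ(X)` of integral operators on `X`. -/
def integralOperators : Set (X →L[𝕜] X) := {T | IsIntegralOperator T}

end Operators

section Multiplication

variable (𝕜 : Type*) [RCLike 𝕜]
variable (A : Type*) [NonUnitalNormedRing A] [NormedSpace 𝕜 A]
  [IsScalarTower 𝕜 A A] [SMulCommClass 𝕜 A A]

/-- The projective tensor product `A ⊗̂ A`: the completion of the algebraic tensor product
`A ⊗ A` under the projective seminorm. -/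
abbrev ProjectiveTensorSquare : Type _ :=
  UniformSpace.Completion (⨂[𝕜] _ : Fin 2, A)

/-- The product `(a, b) ↦ a * b` as a bounded bilinear map. -/
def mulBilinear : ContinuousMultilinearMap 𝕜 (fun _ : Fin 2 => A) A :=
  MultilinearMap.mkContinuous
    { toFun := fun m => m 0 * m 1
      map_update_add' := by
        intro _ m i x y
        fin_cases i <;> simp [add_mul, mul_add]
      map_update_smul' := by
        intro _ m i c x
        fin_cases i <;> simp [smul_mul_assoc, mul_smul_comm] }
    1 (by
      intro m
      simpa [Fin.prod_univ_two] using norm_mul_le (m 0) (m 1))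

/-- The multiplication map `A ⊗̂ A → A`, the bounded linear map with `a ⊗ b ↦ a * b`. -/
def multiplication [CompleteSpace A] : ProjectiveTensorSquare 𝕜 A →L[𝕜] A :=
  (PiTensorProduct.liftIsometry 𝕜 (fun _ : Fin 2 => A) A (mulBilinear 𝕜 A)).extend
    UniformSpace.Completion.toComplL

theorem multiplication_tprod [CompleteSpace A] (m : Fin 2 → A) :
    multiplication 𝕜 A
      ((PiTensorProduct.tprod 𝕜 m : ⨂[𝕜] _ : Fin 2, A) : ProjectiveTensorSquare 𝕜 A)
      = m 0 * m 1 := by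
  have h := ContinuousLinearMap.extend_eq
    (PiTensorProduct.liftIsometry 𝕜 (fun _ : Fin 2 => A) A (mulBilinear 𝕜 A))
    (e := (UniformSpace.Completion.toComplL :
      (⨂[𝕜] _ : Fin 2, A) →L[𝕜] UniformSpace.Completion (⨂[𝕜] _ : Fin 2, A)))
    UniformSpace.Completion.denseRange_coe
    (UniformSpace.Completion.isUniformInducing_coe _) (PiTensorProduct.tprod 𝕜 m)
  refine h.trans ?_
  simp [PiTensorProduct.liftIsometry_apply_apply, mulBilinear]

end Multiplication

end OperatorIdeals

end

noncomputable section

namespace OperatorIdeals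

/-! The bridge is trace duality. The tensor `∑ yᵢ ⊗ fᵢ` in `X ⊗ X*` corresponds to the operator `B =
∑ fᵢ ⊗ yᵢ`; its injective norm is `‖B‖`, and the form of `A` takes the value `tr(AB)` on it
(`injectiveNorm_sum_tmul`, `associatedForm_sum_tmul`). So (iii) says that finite-rank `A` are
integral with constant `C‖A‖`. This passes to norm limits, giving (ii); conversely, (ii) yields a
uniform constant by Banach–Steinhaus. Nuclear operators are integral, so (i) gives (ii).

For (iii) ⇒ (iv), every nuclear operator is a value of `μ`, because `f ⊗ y = (f₀ ⊗ y)(f ⊗ x₀)` when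
`f₀(x₀) = 1` and both have norm one. The other inclusion needs the nuclear norm of `AB` to be at
most a multiple of `‖A‖‖B‖`. For finite rank, a functional norming `AB` in the space of nuclear
operators turns that norm into a trace `tr(AB')` with `‖B'‖ ≤ ‖B‖`, which (iii) bounds. The bound
extends to approximable `A` and `B` by density, then to the projective tensor product by its
universal property. If `μ` is onto `𝒜(X)`, then (iv) literally reads (i). -/

theorem exists_uniform_bound_of_isClosed {𝕜 Z ι : Type*} [RCLike 𝕜] [NormedAddCommGroup Z]
    [NormedSpace 𝕜 Z] [CompleteSpace Z] {p : Submodule 𝕜 Z} (hp : IsClosed (p : Set Z))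
    (F : ι → Z →L[𝕜] 𝕜) (h : ∀ x ∈ p, ∃ C, ∀ i, ‖F i x‖ ≤ C) :
    ∃ C, ∀ i, ∀ x ∈ p, ‖F i x‖ ≤ C * ‖x‖ := by
  have : CompleteSpace p := hp.completeSpace_coe
  obtain ⟨C, hC⟩ := banach_steinhaus (g := fun i => (F i).comp p.subtypeL)
    fun x => h x.1 x.2
  exact ⟨C, fun i x hx => ((F i).comp p.subtypeL).le_of_opNorm_le (hC i) ⟨x, hx⟩⟩

/-! ### Finite-rank operators as sums of rank-one operators, and their trace. -/

section FiniteRank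

variable {𝕜 : Type*} [RCLike 𝕜]
variable {X : Type*} [NormedAddCommGroup X] [NormedSpace 𝕜 X]

theorem mem_finiteRank_iff {T : X →L[𝕜] X} :
    T ∈ finiteRank 𝕜 X ↔ FiniteDimensional 𝕜 (LinearMap.range T.toLinearMap) :=
  Iff.rfl

theorem smulRight_mem_finiteRank (f : StrongDual 𝕜 X) (y : X) :
    f.smulRight y ∈ finiteRank 𝕜 X := by
  rw [mem_finiteRank_iff]
  refine Submodule.finiteDimensional_of_le (S₂ := Submodule.span 𝕜 {y}) ?_
  rintro _ ⟨x, rfl⟩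
  exact Submodule.smul_mem _ _ (Submodule.mem_span_singleton_self y)

theorem sum_smulRight_mem_finiteRank {ι : Type*} (s : Finset ι) (f : ι → StrongDual 𝕜 X)
    (y : ι → X) : ∑ i ∈ s, (f i).smulRight (y i) ∈ finiteRank 𝕜 X :=
  sum_mem fun i _ => smulRight_mem_finiteRank (f i) (y i)

theorem finiteRank_le_approximable : finiteRank 𝕜 X ≤ approximable 𝕜 X :=
  (finiteRank 𝕜 X).le_topologicalClosure

/-- A finite-rank operator is a finite sum of rank-one operators. -/
theorem exists_eq_sum_smulRight {T : X →L[𝕜] X} (hT : T ∈ finiteRank 𝕜 X) :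
    ∃ (n : ℕ) (f : Fin n → StrongDual 𝕜 X) (y : Fin n → X),
      T = ∑ i, (f i).smulRight (y i) := by
  rw [mem_finiteRank_iff] at hT
  let b := Module.finBasis 𝕜 (LinearMap.range T.toLinearMap)
  let R : X →L[𝕜] LinearMap.range T.toLinearMap :=
    T.codRestrict _ fun x => LinearMap.mem_range_self T.toLinearMap x
  refine ⟨_, fun i => (LinearMap.toContinuousLinearMap (b.coord i)).comp R, fun i => b i, ?_⟩
  ext x
  have h := congrArg Subtype.val (b.sum_repr (R x))
  rw [AddSubmonoidClass.coe_finsetSum] at h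
  rw [sum_apply]
  exact h.symm

/-- The trace of `T` may be computed on any finite-dimensional subspace containing its range. -/
theorem finiteRankTrace_eq_trace_restrict (T : X →L[𝕜] X) (W : Submodule 𝕜 X)
    [FiniteDimensional 𝕜 W] (hW : ∀ x, T x ∈ W) :
    finiteRankTrace T =
      LinearMap.trace 𝕜 W (T.toLinearMap.restrict (p := W) (q := W) fun x _ => hW x) := by
  have hle : LinearMap.range T.toLinearMap ≤ W := by
    rintro _ ⟨x, rfl⟩
    exact hW x
  let e := Submodule.submoduleOfEquivOfLe hle
  have hmem : ∀ x : W, T.toLinearMap.restrict (p := W) (q := W) (fun x _ => hW x) x ∈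
      (LinearMap.range T.toLinearMap).submoduleOf W :=
    fun x => ⟨x.1, rfl⟩
  rw [← LinearMap.trace_restrict_eq_of_forall_mem _ _ hmem, ← LinearMap.trace_conj' _ e]
  rfl

theorem finiteRankTrace_sum_smulRight {ι : Type*} (s : Finset ι) (f : ι → StrongDual 𝕜 X)
    (y : ι → X) :
    finiteRankTrace (∑ i ∈ s, (f i).smulRight (y i)) = ∑ i ∈ s, f i (y i) := by
  -- `W` may be strictly larger than the range, but unlike the range it contains every `y i`, so the
  -- restriction splits into rank-one endomorphisms of `W`.
  let W := Submodule.span 𝕜 (y '' s)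
  have : FiniteDimensional 𝕜 W := FiniteDimensional.span_of_finite 𝕜 (s.finite_toSet.image y)
  have hy : ∀ i ∈ s, y i ∈ W := fun i hi => Submodule.subset_span ⟨i, hi, rfl⟩
  have hW : ∀ x, (∑ i ∈ s, (f i).smulRight (y i)) x ∈ W := by
    intro x
    rw [sum_apply]
    exact sum_mem fun i hi => W.smul_mem _ (hy i hi)
  rw [finiteRankTrace_eq_trace_restrict _ W hW]
  have : (∑ i ∈ s, (f i).smulRight (y i)).toLinearMap.restrict (p := W) (q := W)
      (fun x _ => hW x) =
      ∑ i ∈ s.attach, ((f i).toLinearMap.comp W.subtype).smulRight ⟨y i, hy i i.2⟩ := by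
    ext x
    simp only [LinearMap.coe_restrict_apply, ContinuousLinearMap.coe_coe,
      sum_apply, ContinuousLinearMap.smulRight_apply, LinearMap.sum_apply,
      LinearMap.smulRight_apply, LinearMap.comp_apply, Submodule.subtype_apply,
      AddSubmonoidClass.coe_finsetSum, Submodule.coe_smul]
    exact (s.sum_attach fun i => f i x • y i).symm
  rw [this, map_sum]
  simp only [LinearMap.trace_smulRight, LinearMap.comp_apply, Submodule.subtype_apply,
    ContinuousLinearMap.coe_coe]
  exact s.sum_attach fun i => f i (y i)

theorem mul_sum_smulRight {ι : Type*} (A : X →L[𝕜] X) (s : Finset ι)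
    (f : ι → StrongDual 𝕜 X) (y : ι → X) :
    A * ∑ i ∈ s, (f i).smulRight (y i) = ∑ i ∈ s, (f i).smulRight (A (y i)) := by
  ext x
  simp

theorem norm_sum_smulRight_le {ι : Type*} (s : Finset ι) (f : ι → StrongDual 𝕜 X) (y : ι → X)
    {M : ℝ} (hM : 0 ≤ M)
    (h : ∀ x (φ : StrongDual 𝕜 X), ‖∑ i ∈ s, f i x * φ (y i)‖ ≤ M * ‖x‖ * ‖φ‖) :
    ‖∑ i ∈ s, (f i).smulRight (y i)‖ ≤ M := by
  refine ContinuousLinearMap.opNorm_le_bound _ hM fun x => ?_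
  refine NormedSpace.norm_le_dual_bound 𝕜 _ (by positivity) fun φ => ?_
  simpa using h x φ

end FiniteRank

/-! ### The injective norm and integral operators. -/

section Integral

variable {𝕜 : Type*} [RCLike 𝕜]
variable {X : Type*} [NormedAddCommGroup X] [NormedSpace 𝕜 X]
variable {Y : Type*} [NormedAddCommGroup Y] [NormedSpace 𝕜 Y]

theorem injectiveNorm_nonneg (u : X ⊗[𝕜] Y) : 0 ≤ injectiveNorm u :=
  Real.iSup_nonneg fun _ => norm_nonneg _

theorem norm_dualDistrib_le_injectiveNorm (u : X ⊗[𝕜] Y) (f : StrongDual 𝕜 X)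
    (g : StrongDual 𝕜 Y) :
    ‖TensorProduct.dualDistrib 𝕜 X Y ((f : X →ₗ[𝕜] 𝕜) ⊗ₜ[𝕜] (g : Y →ₗ[𝕜] 𝕜)) u‖ ≤
      ‖f‖ * ‖g‖ * injectiveNorm u := by
  have key : ∀ (f : StrongDual 𝕜 X) (g : StrongDual 𝕜 Y), ‖f‖ ≤ 1 → ‖g‖ ≤ 1 →
      ‖TensorProduct.dualDistrib 𝕜 X Y ((f : X →ₗ[𝕜] 𝕜) ⊗ₜ[𝕜] (g : Y →ₗ[𝕜] 𝕜)) u‖ ≤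
        injectiveNorm u := fun f g hf hg =>
    le_ciSup (bddAbove_injectiveNorm u)
      (⟨⟨f, mem_closedBall_zero_iff.2 hf⟩, ⟨g, mem_closedBall_zero_iff.2 hg⟩⟩ :
        Metric.closedBall (0 : StrongDual 𝕜 X) 1 × Metric.closedBall (0 : StrongDual 𝕜 Y) 1)
  rcases eq_or_ne f 0 with rfl | hf
  · simp
  rcases eq_or_ne g 0 with rfl | hg
  · simp
  have hf' := norm_pos_iff.2 hf
  have hg' := norm_pos_iff.2 hg
  have h := key (((‖f‖⁻¹ : ℝ) : 𝕜) • f) (((‖g‖⁻¹ : ℝ) : 𝕜) • g)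
    (by rw [norm_smul, RCLike.norm_ofReal, abs_of_pos (by positivity), inv_mul_cancel₀ hf'.ne'])
    (by rw [norm_smul, RCLike.norm_ofReal, abs_of_pos (by positivity), inv_mul_cancel₀ hg'.ne'])
  simp only [ContinuousLinearMap.toLinearMap_smul, ← TensorProduct.smul_tmul',
    TensorProduct.tmul_smul, map_smul,
    LinearMap.smul_apply, norm_smul, RCLike.norm_ofReal, abs_inv, abs_norm] at h
  calc _ = ‖f‖ * ‖g‖ * (‖f‖⁻¹ * (‖g‖⁻¹ * _)) := by field_simp
    _ ≤ _ := by
      refine mul_le_mul_of_nonneg_left ?_ (by positivity)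
      rw [mul_left_comm]
      exact h

theorem associatedForm_tmul (T : X →L[𝕜] Y) (x : X) (g : StrongDual 𝕜 Y) :
    associatedForm T (x ⊗ₜ g) = g (T x) := by
  simp [associatedForm]

/-- The associated form, as a continuous linear functional of the operator. -/
def associatedFormL (u : X ⊗[𝕜] StrongDual 𝕜 Y) : (X →L[𝕜] Y) →L[𝕜] 𝕜 where
  toFun T := associatedForm T u
  map_add' S T := by
    induction u with
    | zero => simp
    | tmul x g => simp [associatedForm_tmul]
    | add u v hu hv => rw [map_add, map_add, map_add, hu, hv]; abel
  map_smul' c T := by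
    induction u with
    | zero => simp
    | tmul x g => simp [associatedForm_tmul]
    | add u v hu hv => rw [map_add, map_add, hu, hv, smul_add]
  cont := by
    induction u with
    | zero => simpa using continuous_const
    | tmul x g =>
      simp only [associatedForm_tmul]
      fun_prop
    | add u v hu hv =>
      simp only [map_add]
      exact hu.add hv

@[simp]
theorem associatedFormL_apply (u : X ⊗[𝕜] StrongDual 𝕜 Y) (T : X →L[𝕜] Y) :
    associatedFormL u T = associatedForm T u := rfl

/-- Nuclear operators are integral. -/
theorem IsNuclear.isIntegralOperator {T : X →L[𝕜] Y} (hT : IsNuclear T) :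
    IsIntegralOperator T := by
  obtain ⟨f, y, hs, hT⟩ := hT
  refine ⟨∑' n, ‖f n‖ * ‖y n‖, fun u => ?_⟩
  -- Seen in the bidual, each `y n` makes `f n ⊗ y n` an elementary functional on `X ⊗ Y*`, which
  -- the injective norm controls.
  let ev : Y → StrongDual 𝕜 (StrongDual 𝕜 Y) := NormedSpace.inclusionInDoubleDual 𝕜 Y
  have hsum : HasSum (fun n => TensorProduct.dualDistrib 𝕜 X (StrongDual 𝕜 Y)
      ((f n : X →ₗ[𝕜] 𝕜) ⊗ₜ[𝕜] (ev (y n) : StrongDual 𝕜 Y →ₗ[𝕜] 𝕜)) u)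
      (associatedForm T u) := by
    induction u with
    | zero => simp
    | tmul x g =>
      have := (hT x).mapL g
      simpa [associatedForm_tmul, ev] using this
    | add u v hu hv => simpa using hu.add hv
  have hb : ∀ n, ‖TensorProduct.dualDistrib 𝕜 X (StrongDual 𝕜 Y)
      ((f n : X →ₗ[𝕜] 𝕜) ⊗ₜ[𝕜] (ev (y n) : StrongDual 𝕜 Y →ₗ[𝕜] 𝕜)) u‖ ≤
      ‖f n‖ * ‖y n‖ * injectiveNorm u := fun n =>
    (norm_dualDistrib_le_injectiveNorm u _ _).trans <|
      mul_le_mul_of_nonneg_right (mul_le_mul_of_nonneg_left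
        (NormedSpace.double_dual_bound 𝕜 Y (y n)) (norm_nonneg _)) (injectiveNorm_nonneg u)
  rw [← tsum_mul_right, ← hsum.tsum_eq]
  exact tsum_of_norm_bounded (hs.mul_right _).hasSum hb

end Integral

/-! ### Trace duality: (ii) ⇔ (iii). -/

section TraceDuality

variable {𝕜 : Type*} [RCLike 𝕜]
variable {X : Type*} [NormedAddCommGroup X] [NormedSpace 𝕜 X]

theorem associatedForm_sum_tmul (A : X →L[𝕜] X) {ι : Type*} (s : Finset ι)
    (f : ι → StrongDual 𝕜 X) (y : ι → X) :
    associatedForm A (∑ i ∈ s, y i ⊗ₜ[𝕜] f i) =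
      finiteRankTrace (A * ∑ i ∈ s, (f i).smulRight (y i)) := by
  rw [mul_sum_smulRight, finiteRankTrace_sum_smulRight, map_sum]
  simp [associatedForm_tmul]

/-- The injective norm of a tensor is the operator norm of the corresponding finite-rank
operator. -/
theorem injectiveNorm_sum_tmul {ι : Type*} (s : Finset ι) (f : ι → StrongDual 𝕜 X) (y : ι → X) :
    injectiveNorm (∑ i ∈ s, y i ⊗ₜ[𝕜] f i) = ‖∑ i ∈ s, (f i).smulRight (y i)‖ := by
  apply le_antisymm
  · refine Real.iSup_le (fun ⟨⟨φ, hφ⟩, ⟨F, hF⟩⟩ => ?_) (norm_nonneg _)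
    rw [mem_closedBall_zero_iff] at hφ hF
    set B := ∑ i ∈ s, (f i).smulRight (y i) with hB
    -- Applying `φ` to the first factor leaves the functional `∑ φ(yᵢ) fᵢ = φ ∘ B`, on which `F` is
    -- evaluated.
    have h : TensorProduct.dualDistrib 𝕜 X (StrongDual 𝕜 X)
        ((φ : X →ₗ[𝕜] 𝕜) ⊗ₜ[𝕜] (F : StrongDual 𝕜 X →ₗ[𝕜] 𝕜)) (∑ i ∈ s, y i ⊗ₜ[𝕜] f i) =
        F (φ.comp B) := by
      have : φ.comp B = ∑ i ∈ s, φ (y i) • f i := by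
        ext x
        simp [hB, mul_comm]
      rw [this]
      simp
    rw [h]
    calc ‖F (φ.comp B)‖ ≤ 1 * (1 * ‖B‖) := F.le_of_opNorm_le_of_le hF
          ((φ.opNorm_comp_le B).trans (mul_le_mul_of_nonneg_right hφ (norm_nonneg _)))
      _ = ‖B‖ := by ring
  -- Here point evaluations suffice as elements of the bidual.
  · refine norm_sum_smulRight_le s f y (injectiveNorm_nonneg _) fun x φ => ?_
    have h := norm_dualDistrib_le_injectiveNorm (∑ i ∈ s, y i ⊗ₜ[𝕜] f i) φ
      (NormedSpace.inclusionInDoubleDual 𝕜 X x)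
    have h2 : TensorProduct.dualDistrib 𝕜 X (StrongDual 𝕜 X) ((φ : X →ₗ[𝕜] 𝕜) ⊗ₜ[𝕜]
        (NormedSpace.inclusionInDoubleDual 𝕜 X x : StrongDual 𝕜 X →ₗ[𝕜] 𝕜))
        (∑ i ∈ s, y i ⊗ₜ[𝕜] f i) = ∑ i ∈ s, f i x * φ (y i) := by
      simp [mul_comm]
    rw [h2] at h
    refine h.trans ?_
    have := mul_le_mul_of_nonneg_left (NormedSpace.double_dual_bound 𝕜 X x) (norm_nonneg φ)
    calc _ ≤ ‖φ‖ * ‖x‖ * _ := mul_le_mul_of_nonneg_right this (injectiveNorm_nonneg _)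
      _ = _ := by ring

/-- Integrality of `T` says that the functionals `T ↦ associatedForm T u`, with `u` in the injective
unit ball, are bounded at `T`. Uniform boundedness on the Banach space `𝒜(X)` makes the bound linear
in `‖T‖`, and trace duality rewrites it. -/
theorem exists_bound_of_approximable_subset_integralOperators [CompleteSpace X]
    (h : (approximable 𝕜 X : Set (X →L[𝕜] X)) ⊆ integralOperators 𝕜 X) :
    ∃ C : ℝ, 0 < C ∧ ∀ A ∈ finiteRank 𝕜 X, ∀ B ∈ finiteRank 𝕜 X,
      ‖finiteRankTrace (A * B)‖ ≤ C * ‖A‖ * ‖B‖ := by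
  have hF : ∀ T ∈ (approximable 𝕜 X).toSubmodule, ∃ C,
      ∀ u : {u : X ⊗[𝕜] StrongDual 𝕜 X // injectiveNorm u ≤ 1}, ‖associatedFormL u.1 T‖ ≤ C := by
    intro T hT
    obtain ⟨C, hC⟩ := h hT
    refine ⟨|C|, fun ⟨u, hu⟩ => (hC u).trans ?_⟩
    calc C * injectiveNorm u ≤ |C| * 1 :=
          mul_le_mul (le_abs_self C) hu (injectiveNorm_nonneg u) (abs_nonneg C)
      _ = |C| := mul_one _
  obtain ⟨C, hC⟩ := exists_uniform_bound_of_isClosed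
    (finiteRank 𝕜 X).isClosed_topologicalClosure _ hF
  -- The Banach–Steinhaus constant has no known sign, while (iii) asks for a positive one.
  refine ⟨|C| + 1, by positivity, fun A hA B hB => ?_⟩
  obtain ⟨n, f, y, rfl⟩ := exists_eq_sum_smulRight hB
  set B := ∑ i, (f i).smulRight (y i) with hBdef
  rcases eq_or_ne B 0 with h0 | h0
  · have := finiteRankTrace_sum_smulRight (∅ : Finset ℕ) (0 : ℕ → StrongDual 𝕜 X) (0 : ℕ → X)
    simp only [Finset.sum_empty] at this
    simp [h0, this]
  have hpos : 0 < ‖B‖ := norm_pos_iff.2 h0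
  let c : 𝕜 := ((‖B‖⁻¹ : ℝ) : 𝕜)
  have hc : ‖c‖ = ‖B‖⁻¹ := by
    rw [RCLike.norm_ofReal, abs_of_pos (by positivity)]
  have hcB : ∑ i, (c • f i).smulRight (y i) = c • B := by
    ext x
    simp [hBdef, Finset.smul_sum, mul_smul]
  have hle : injectiveNorm (∑ i, y i ⊗ₜ[𝕜] (c • f i)) ≤ 1 := by
    rw [injectiveNorm_sum_tmul, hcB, norm_smul, hc, inv_mul_cancel₀ hpos.ne']
  have h2 := hC ⟨_, hle⟩ A (finiteRank_le_approximable hA)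
  have h3 : associatedForm A (∑ i, y i ⊗ₜ[𝕜] (c • f i)) = c * finiteRankTrace (A * B) := by
    simp only [TensorProduct.tmul_smul, ← Finset.smul_sum, map_smul, smul_eq_mul]
    rw [associatedForm_sum_tmul]
  have h4 : ‖c * finiteRankTrace (A * B)‖ ≤ C * ‖A‖ := by
    rw [← h3]
    exact h2
  rw [norm_mul, hc, inv_mul_le_iff₀ hpos] at h4
  calc _ ≤ ‖B‖ * (C * ‖A‖) := h4
    _ ≤ ‖B‖ * ((|C| + 1) * ‖A‖) := by
      gcongr
      linarith [le_abs_self C]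
    _ = _ := by ring

/-- For fixed `u`, the estimate with constant `C * ‖A‖` is a closed condition on `A`, so it passes
from `ℱ(X)` to its closure. -/
theorem approximable_subset_integralOperators_of_bound {C : ℝ}
    (h : ∀ A ∈ finiteRank 𝕜 X, ∀ B ∈ finiteRank 𝕜 X,
      ‖finiteRankTrace (A * B)‖ ≤ C * ‖A‖ * ‖B‖) :
    (approximable 𝕜 X : Set (X →L[𝕜] X)) ⊆ integralOperators 𝕜 X := by
  intro T hT
  refine ⟨C * ‖T‖, fun u => ?_⟩
  obtain ⟨S, rfl⟩ := TensorProduct.exists_finset u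
  have hclosed : IsClosed {A : X →L[𝕜] X | ‖associatedFormL (∑ i ∈ S, i.1 ⊗ₜ[𝕜] i.2) A‖ ≤
      C * ‖A‖ * injectiveNorm (∑ i ∈ S, i.1 ⊗ₜ[𝕜] i.2)} :=
    isClosed_le (by fun_prop) (by fun_prop)
  have hsub : (finiteRank 𝕜 X : Set (X →L[𝕜] X)) ⊆ {A : X →L[𝕜] X |
      ‖associatedFormL (∑ i ∈ S, i.1 ⊗ₜ[𝕜] i.2) A‖ ≤
      C * ‖A‖ * injectiveNorm (∑ i ∈ S, i.1 ⊗ₜ[𝕜] i.2)} := by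
    intro A hA
    simp only [Set.mem_ofPred_eq, associatedFormL_apply]
    rw [associatedForm_sum_tmul A S (fun i => i.2) (fun i => i.1),
      injectiveNorm_sum_tmul S (fun i => i.2) (fun i => i.1)]
    exact h A hA _ (sum_smulRight_mem_finiteRank _ _ _)
  exact closure_minimal hsub hclosed hT

end TraceDuality

/-! ### Extending bounded lifts to a closure. -/

section ControlledLift

variable {𝕜 N Z W : Type*} [RCLike 𝕜]
  [NormedAddCommGroup N] [NormedSpace 𝕜 N] [CompleteSpace N]
  [NormedAddCommGroup Z] [NormedSpace 𝕜 Z] [CompleteSpace Z]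
  [NormedAddCommGroup W] [NormedSpace 𝕜 W]

/-- The pullback `P = {(τ, g) | J τ = M g}` is a Banach space under the sup norm, and its projection
to `Z` hits `K` with constant `1`. Successive approximation then hits the closure with constant `1 +
ε`; here `ε = 1`. -/
theorem exists_lift_two_mul_norm_of_mem_closure_of_norm_le (J : N →L[𝕜] W) (M : Z →L[𝕜] W)
    (K : AddSubgroup Z) (h : ∀ g ∈ K, ∃ τ, J τ = M g ∧ ‖τ‖ ≤ ‖g‖) :
    ∀ g ∈ K.topologicalClosure, ∃ τ, J τ = M g ∧ ‖τ‖ ≤ 2 * ‖g‖ := by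
  let P : Submodule 𝕜 (N × Z) :=
    (J.comp (ContinuousLinearMap.fst 𝕜 N Z) - M.comp (ContinuousLinearMap.snd 𝕜 N Z)).ker
  have hmem : ∀ p : N × Z, p ∈ P ↔ J p.1 = M p.2 := fun p => by
    simp [P, sub_eq_zero]
  have hP : IsClosed (P : Set (N × Z)) := ContinuousLinearMap.isClosed_ker _
  have : CompleteSpace P := hP.completeSpace_coe
  let f : NormedAddGroupHom P Z :=
    { toFun := fun p => p.1.2
      map_add' := fun _ _ => rfl
      bound' := ⟨1, fun p => by simpa using norm_snd_le p.1⟩ }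
  have hf : f.SurjectiveOnWith K 1 := by
    intro g hg
    obtain ⟨τ, hτ, hle⟩ := h g hg
    exact ⟨⟨(τ, g), (hmem _).2 hτ⟩, rfl, by
      rw [one_mul]
      exact (norm_prod_le_iff (x := (τ, g))).2 ⟨hle, le_rfl⟩⟩
  intro g hg
  obtain ⟨⟨⟨τ, g'⟩, hp⟩, rfl, hle⟩ := controlled_closure_of_complete one_pos one_pos hf g hg
  refine ⟨τ, (hmem _).1 hp, ?_⟩
  rw [one_add_one_eq_two] at hle
  exact (norm_fst_le (τ, g')).trans hle

theorem exists_lift_of_mem_closure (J : N →L[𝕜] W) (M : Z →L[𝕜] W) (K : AddSubgroup Z) {C : ℝ}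
    (hC : 0 < C) (h : ∀ g ∈ K, ∃ τ, J τ = M g ∧ ‖τ‖ ≤ C * ‖g‖) :
    ∀ g ∈ K.topologicalClosure, ∃ τ, J τ = M g ∧ ‖τ‖ ≤ 2 * C * ‖g‖ := by
  have hn : ‖(C : 𝕜)‖ = C := by rw [RCLike.norm_ofReal, abs_of_pos hC]
  have hC0 : (C : 𝕜) ≠ 0 := by exact_mod_cast hC.ne'
  intro g hg
  obtain ⟨τ, hτ, hle⟩ := exists_lift_two_mul_norm_of_mem_closure_of_norm_le J
    ((C : 𝕜)⁻¹ • M) K (fun g hg => by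
      obtain ⟨τ, hτ, hle⟩ := h g hg
      refine ⟨(C : 𝕜)⁻¹ • τ, by simp [hτ], ?_⟩
      rw [norm_smul, norm_inv, hn, inv_mul_le_iff₀ hC]
      exact hle) g hg
  refine ⟨(C : 𝕜) • τ, by simp [hτ, smul_smul, hC0], ?_⟩
  rw [norm_smul, hn]
  calc C * ‖τ‖ ≤ C * (2 * ‖g‖) := by gcongr
    _ = _ := by ring

end ControlledLift

section Normalize

variable (𝕜 : Type*) [RCLike 𝕜] {V : Type*} [NormedAddCommGroup V] [NormedSpace 𝕜 V]

theorem inv_norm_smul_mem_closedBall (v : V) :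
    ((‖v‖⁻¹ : ℝ) : 𝕜) • v ∈ Metric.closedBall (0 : V) 1 := by
  rw [mem_closedBall_zero_iff, norm_smul, RCLike.norm_ofReal, abs_inv, abs_norm]
  exact inv_mul_le_one

theorem norm_smul_inv_norm_smul (v : V) : (‖v‖ : 𝕜) • ((‖v‖⁻¹ : ℝ) : 𝕜) • v = v := by
  rcases eq_or_ne v 0 with rfl | hv
  · simp
  · have : (‖v‖ : 𝕜) ≠ 0 := by simpa using hv
    simp [smul_smul, this]

end Normalize

/-! ### The Banach space of nuclear operators and the nuclear norm of products. -/

section NuclearSpace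

variable (𝕜 : Type*) [RCLike 𝕜]
variable (X : Type*) [NormedAddCommGroup X] [NormedSpace 𝕜 X]

/-- Pairs consisting of a functional and a vector in the closed unit balls. -/
abbrev UnitPairs : Type _ :=
  Metric.closedBall (0 : StrongDual 𝕜 X) 1 × Metric.closedBall (0 : X) 1

/-- The space `ℓ¹` over the pairs of functionals and vectors in the unit balls. -/
abbrev UnitPairsL1 : Type _ := lp (fun _ : UnitPairs 𝕜 X => 𝕜) 1

variable {𝕜 X}

theorem hasSum_norm_lp_one {ι : Type*} (c : lp (fun _ : ι => 𝕜) 1) :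
    HasSum (fun i => ‖c i‖) ‖c‖ := by
  simpa using lp.hasSum_norm (p := 1) (by simp) c

theorem norm_smulRight_unitPair_le (i : UnitPairs 𝕜 X) :
    ‖(i.1.1).smulRight i.2.1‖ ≤ 1 := by
  rw [ContinuousLinearMap.norm_smulRight_apply]
  exact mul_le_one₀ (mem_closedBall_zero_iff.1 i.1.2) (norm_nonneg _)
    (mem_closedBall_zero_iff.1 i.2.2)

theorem norm_smul_smulRight_unitPair_le (c : 𝕜) (i : UnitPairs 𝕜 X) :
    ‖c • (i.1.1).smulRight i.2.1‖ ≤ ‖c‖ := by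
  rw [norm_smul]
  exact mul_le_of_le_one_right (norm_nonneg _) (norm_smulRight_unitPair_le i)

variable [CompleteSpace X]

theorem summable_smul_smulRight_unitPair (c : UnitPairsL1 𝕜 X) :
    Summable fun i : UnitPairs 𝕜 X => c i • (i.1.1).smulRight i.2.1 :=
  Summable.of_norm_bounded (hasSum_norm_lp_one c).summable
    fun i => norm_smul_smulRight_unitPair_le (c i) i

variable (𝕜 X)

/-- The operator `∑ cᵢ fᵢ ⊗ yᵢ` attached to a summable family of coefficients. -/
def unitPairsSum : UnitPairsL1 𝕜 X →L[𝕜] X →L[𝕜] X :=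
  LinearMap.mkContinuous
    { toFun := fun c => ∑' i : UnitPairs 𝕜 X, c i • (i.1.1).smulRight i.2.1
      map_add' := fun c d => by
        rw [← (summable_smul_smulRight_unitPair c).tsum_add (summable_smul_smulRight_unitPair d)]
        simp [add_smul]
      map_smul' := fun a c => by
        rw [RingHom.id_apply, ← (summable_smul_smulRight_unitPair c).tsum_const_smul]
        simp [mul_smul] }
    1 (fun c => by
      rw [one_mul]
      exact tsum_of_norm_bounded (hasSum_norm_lp_one c)
        fun i => norm_smul_smulRight_unitPair_le (c i) i)

variable {𝕜 X} in
theorem hasSum_unitPairsSum (c : UnitPairsL1 𝕜 X) :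
    HasSum (fun i : UnitPairs 𝕜 X => c i • (i.1.1).smulRight i.2.1) (unitPairsSum 𝕜 X c) :=
  (summable_smul_smulRight_unitPair c).hasSum

instance : IsClosed ((unitPairsSum 𝕜 X).ker : Set (UnitPairsL1 𝕜 X)) :=
  ContinuousLinearMap.isClosed_ker _

/-- The Banach space of nuclear operators with the nuclear norm, as a quotient of `ℓ¹`. -/
abbrev NuclearSpace : Type _ := UnitPairsL1 𝕜 X ⧸ (unitPairsSum 𝕜 X).ker

/-- The operator underlying an element of the space of nuclear operators. -/
def NuclearSpace.toOperator : NuclearSpace 𝕜 X →L[𝕜] X →L[𝕜] X :=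
  (unitPairsSum 𝕜 X).ker.liftQL (unitPairsSum 𝕜 X) le_rfl

variable {𝕜 X}

/-- Quotienting by the whole kernel identifies representations of the same operator, so identities
in `NuclearSpace` can be checked on operators. -/
theorem NuclearSpace.toOperator_injective : Function.Injective (toOperator 𝕜 X) :=
  LinearMap.ker_eq_bot.1 (Submodule.ker_liftQ_eq_bot _ _ _ le_rfl)

/-- A summable family has countable support, so it can be reindexed by `ℕ` and padded with zeros. -/
theorem isNuclear_unitPairsSum (c : UnitPairsL1 𝕜 X) : IsNuclear (unitPairsSum 𝕜 X c) := by
  have hc := (hasSum_norm_lp_one c).summable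
  let S : Set (UnitPairs 𝕜 X) := Function.support fun i => ‖c i‖
  have hS : S.Countable := hc.countable_support
  obtain ⟨e, he⟩ := Set.countable_iff_exists_injOn.1 hS
  have hinj : Function.Injective fun s : S => e s := fun a b h => Subtype.ext (he a.2 b.2 h)
  have hs : Summable fun s : S => ‖c s‖ := hc.subtype S
  refine ⟨Function.extend (fun s : S => e s) (fun s => c s • s.1.1.1) 0,
    Function.extend (fun s : S => e s) (fun s => s.1.2.1) 0, ?_, fun x => ?_⟩
  · have hfun : (fun n => ‖Function.extend (fun s : S => e s) (fun s => c s • s.1.1.1) 0 n‖ *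
        ‖Function.extend (fun s : S => e s) (fun s => s.1.2.1) 0 n‖) =
        Function.extend (fun s : S => e s) (fun s => ‖c s • s.1.1.1‖ * ‖s.1.2.1‖) 0 := by
      ext n
      by_cases hn : ∃ s : S, e s = n
      · obtain ⟨s, rfl⟩ := hn
        simp only [hinj.extend_apply (g := fun s : S => (c s • s.1.1.1 : StrongDual 𝕜 X)) 0 s,
          hinj.extend_apply (g := fun s : S => (s.1.2.1 : X)) 0 s,
          hinj.extend_apply (g := fun s : S => ‖c s • s.1.1.1‖ * ‖s.1.2.1‖) 0 s]
      · simp [Function.extend_apply' _ _ _ hn]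
    rw [hfun, summable_extend_zero hinj]
    refine Summable.of_nonneg_of_le (fun _ => by positivity) (fun s => ?_) hs
    rw [← ContinuousLinearMap.norm_smulRight_apply]
    have hsmul : (c s • s.1.1.1).smulRight s.1.2.1 = c s • (s.1.1.1).smulRight s.1.2.1 := by
      ext x
      simp [mul_smul]
    rw [hsmul]
    exact norm_smul_smulRight_unitPair_le (c s) s.1
  · have hfun : (fun n => Function.extend (fun s : S => e s) (fun s => c s • s.1.1.1) 0 n x •
        Function.extend (fun s : S => e s) (fun s => s.1.2.1) 0 n) =
        Function.extend (fun s : S => e s) (fun s => (c s • s.1.1.1) x • s.1.2.1) 0 := by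
      ext n
      by_cases hn : ∃ s : S, e s = n
      · obtain ⟨s, rfl⟩ := hn
        simp only [hinj.extend_apply (g := fun s : S => (c s • s.1.1.1 : StrongDual 𝕜 X)) 0 s,
          hinj.extend_apply (g := fun s : S => (s.1.2.1 : X)) 0 s,
          hinj.extend_apply (g := fun s : S => (c s • s.1.1.1) x • s.1.2.1) 0 s]
      · simp [Function.extend_apply' _ _ _ hn]
    rw [hfun, hasSum_extend_zero hinj]
    have h1 := (hasSum_unitPairsSum c).mapL (ContinuousLinearMap.apply 𝕜 X x)
    have h2 : Function.support (fun i : UnitPairs 𝕜 X =>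
        ContinuousLinearMap.apply 𝕜 X x (c i • (i.1.1).smulRight i.2.1)) ⊆ S := by
      intro i hi
      contrapose! hi
      have : c i = 0 := by simpa [S] using hi
      simp [this]
    have h3 := (hasSum_subtype_iff_of_support_subset h2).2 h1
    simpa [Function.comp_def, mul_smul] using h3

theorem NuclearSpace.isNuclear_toOperator (τ : NuclearSpace 𝕜 X) :
    IsNuclear (toOperator 𝕜 X τ) := by
  obtain ⟨c, rfl⟩ := Submodule.Quotient.mk_surjective _ τ
  exact isNuclear_unitPairsSum c

theorem NuclearSpace.exists_toOperator_eq_smulRight (f : StrongDual 𝕜 X) (y : X) :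
    ∃ τ, toOperator 𝕜 X τ = f.smulRight y ∧ ‖τ‖ ≤ ‖f‖ * ‖y‖ := by
  classical
  -- The normalised pair, with coefficient `‖f‖‖y‖`. If `f` or `y` vanishes, the convention `0⁻¹ =
  -- 0` keeps the pair in the balls and the coefficient is zero.
  let i : UnitPairs 𝕜 X :=
    (⟨_, inv_norm_smul_mem_closedBall 𝕜 f⟩, ⟨_, inv_norm_smul_mem_closedBall 𝕜 y⟩)
  let c : UnitPairsL1 𝕜 X := lp.single 1 i ((‖f‖ : 𝕜) * (‖y‖ : 𝕜))
  refine ⟨Submodule.Quotient.mk c, ?_, ?_⟩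
  · have h1 := hasSum_unitPairsSum c
    have h2 : HasSum (fun i : UnitPairs 𝕜 X => c i • (i.1.1).smulRight i.2.1)
        (c i • (i.1.1).smulRight i.2.1) := hasSum_single i fun j hj => by
      simp [c, Pi.single_eq_of_ne hj]
    have h3 : unitPairsSum 𝕜 X c = f.smulRight y := by
      rw [h1.unique h2]
      ext x
      conv_rhs => rw [← norm_smul_inv_norm_smul 𝕜 f, ← norm_smul_inv_norm_smul 𝕜 y]
      simp only [c, i, lp.single_apply_self, smul_apply,
        ContinuousLinearMap.smulRight_apply, smul_smul, smul_eq_mul]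
      ring_nf
    exact h3
  · refine (Submodule.Quotient.norm_mk_le _ c).trans ?_
    rw [lp.norm_single (by simp)]
    simp

/-- The rank-one operator `f ⊗ y` as an element of the space of nuclear operators, as a bounded
bilinear map. -/
def NuclearSpace.rankOne : StrongDual 𝕜 X →L[𝕜] X →L[𝕜] NuclearSpace 𝕜 X :=
  have h (f : StrongDual 𝕜 X) (y : X) :=
    (exists_toOperator_eq_smulRight f y).choose_spec
  LinearMap.mkContinuous₂
    (LinearMap.mk₂ 𝕜 (fun f y => (exists_toOperator_eq_smulRight f y).choose)
      (fun f g y => toOperator_injective (by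
        rw [map_add, (h _ _).1, (h _ _).1, (h _ _).1]; ext x; simp [add_smul]))
      (fun a f y => toOperator_injective (by
        rw [map_smul, (h _ _).1, (h _ _).1]; ext x; simp [mul_smul]))
      (fun f y z => toOperator_injective (by
        rw [map_add, (h _ _).1, (h _ _).1, (h _ _).1]; ext x; simp))
      (fun a f y => toOperator_injective (by
        rw [map_smul, (h _ _).1, (h _ _).1]; ext x; simp [smul_comm a])))
    1 (fun f y => by rw [one_mul]; exact (h f y).2)

@[simp]
theorem NuclearSpace.toOperator_rankOne (f : StrongDual 𝕜 X) (y : X) :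
    toOperator 𝕜 X (rankOne f y) = f.smulRight y :=
  (exists_toOperator_eq_smulRight f y).choose_spec.1

theorem NuclearSpace.norm_rankOne_le (f : StrongDual 𝕜 X) (y : X) :
    ‖rankOne f y‖ ≤ ‖f‖ * ‖y‖ :=
  (exists_toOperator_eq_smulRight f y).choose_spec.2

/-- A trace bound for products of finite-rank operators bounds the nuclear norm of such products.
A norming functional of the nuclear norm is turned into an operator `S` on the dual, and
`S ∘ B*` is again the adjoint of a finite-rank operator. -/
theorem exists_toOperator_eq_mul_of_finiteRank {C : ℝ} (hC : 0 ≤ C)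
    (h : ∀ A ∈ finiteRank 𝕜 X, ∀ B ∈ finiteRank 𝕜 X,
      ‖finiteRankTrace (A * B)‖ ≤ C * ‖A‖ * ‖B‖)
    {A B : X →L[𝕜] X} (hA : A ∈ finiteRank 𝕜 X) (hB : B ∈ finiteRank 𝕜 X) :
    ∃ τ, NuclearSpace.toOperator 𝕜 X τ = A * B ∧ ‖τ‖ ≤ C * ‖A‖ * ‖B‖ := by
  obtain ⟨n, f, b, rfl⟩ := exists_eq_sum_smulRight hB
  set B := ∑ i, (f i).smulRight (b i) with hBdef
  refine ⟨∑ i, NuclearSpace.rankOne (f i) (A (b i)), ?_, ?_⟩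
  · rw [hBdef, mul_sum_smulRight, map_sum]
    simp
  obtain ⟨Λ, hΛ, hΛτ⟩ := exists_dual_vector'' 𝕜 (∑ i, NuclearSpace.rankOne (f i) (A (b i)))
  let S : StrongDual 𝕜 X → StrongDual 𝕜 X := fun g => Λ.comp (NuclearSpace.rankOne g)
  have hS : ∀ g x, ‖S g x‖ ≤ ‖g‖ * ‖x‖ := fun g x =>
    (Λ.le_of_opNorm_le_of_le hΛ (NuclearSpace.norm_rankOne_le g x)).trans (one_mul _).le
  -- The adjoint of this operator sends `φ` to `S (φ ∘ B)`, and `S` is a contraction.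
  have hB' : ‖∑ i, (S (f i)).smulRight (b i)‖ ≤ ‖B‖ := by
    refine norm_sum_smulRight_le _ _ _ (norm_nonneg _) fun x φ => ?_
    have h1 : ∑ i, S (f i) x * φ (b i) = S (φ.comp B) x := by
      have : φ.comp B = ∑ i, φ (b i) • f i := by
        ext z
        simp [hBdef, mul_comm]
      rw [this]
      simp [S, mul_comm]
    rw [h1]
    calc _ ≤ ‖φ.comp B‖ * ‖x‖ := hS _ _
      _ ≤ ‖φ‖ * ‖B‖ * ‖x‖ := by gcongr; exact φ.opNorm_comp_le B
      _ = _ := by ring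
  have h2 := h A hA _ (sum_smulRight_mem_finiteRank Finset.univ (fun i => S (f i)) b)
  rw [mul_sum_smulRight, finiteRankTrace_sum_smulRight] at h2
  have h3 : ∑ i, S (f i) (A (b i)) = (‖∑ i, NuclearSpace.rankOne (f i) (A (b i))‖ : 𝕜) := by
    rw [← hΛτ, map_sum]
    rfl
  rw [h3, RCLike.norm_ofReal, abs_norm] at h2
  exact h2.trans (by gcongr)

/-- Density is used in one factor at a time, first `A` and then `B`; each passage to the closure
doubles the constant. -/
theorem exists_toOperator_eq_mul_of_approximable {C : ℝ} (hC : 0 < C)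
    (h : ∀ A ∈ finiteRank 𝕜 X, ∀ B ∈ finiteRank 𝕜 X,
      ‖finiteRankTrace (A * B)‖ ≤ C * ‖A‖ * ‖B‖)
    {A B : X →L[𝕜] X} (hA : A ∈ approximable 𝕜 X) (hB : B ∈ approximable 𝕜 X) :
    ∃ τ, NuclearSpace.toOperator 𝕜 X τ = A * B ∧ ‖τ‖ ≤ 4 * C * ‖A‖ * ‖B‖ := by
  have key : ∀ B ∈ finiteRank 𝕜 X,
      ∃ τ, NuclearSpace.toOperator 𝕜 X τ = A * B ∧ ‖τ‖ ≤ 2 * C * ‖A‖ * ‖B‖ := by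
    intro B hB
    -- The lifting constant `C * ‖B‖` must be positive.
    rcases eq_or_ne B 0 with rfl | h0
    · exact ⟨0, by simp, by simp⟩
    have hpos := norm_pos_iff.2 h0
    obtain ⟨τ, hτ, hle⟩ := exists_lift_of_mem_closure (NuclearSpace.toOperator 𝕜 X)
      ((ContinuousLinearMap.mul 𝕜 (X →L[𝕜] X)).flip B)
      (finiteRank 𝕜 X).toSubmodule.toAddSubgroup (C := C * ‖B‖) (by positivity)
      (fun A hA => by
        obtain ⟨τ, hτ, hle⟩ := exists_toOperator_eq_mul_of_finiteRank hC.le h hA hB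
        exact ⟨τ, hτ, hle.trans (by linarith)⟩) A hA
    exact ⟨τ, hτ, hle.trans (by linarith)⟩
  rcases eq_or_ne A 0 with rfl | h0
  · exact ⟨0, by simp, by simp⟩
  have hpos := norm_pos_iff.2 h0
  obtain ⟨τ, hτ, hle⟩ := exists_lift_of_mem_closure (NuclearSpace.toOperator 𝕜 X)
    (ContinuousLinearMap.mul 𝕜 (X →L[𝕜] X) A)
    (finiteRank 𝕜 X).toSubmodule.toAddSubgroup (C := 2 * C * ‖A‖) (by positivity) key B hB
  exact ⟨τ, hτ, hle.trans (by linarith)⟩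

end NuclearSpace

/-! ### Lifting the multiplication map, and sums of products in its image. -/

section Multiplication

variable {𝕜 : Type*} [RCLike 𝕜]
variable {A : Type*} [NonUnitalNormedRing A] [NormedSpace 𝕜 A]
  [IsScalarTower 𝕜 A A] [SMulCommClass 𝕜 A A] [CompleteSpace A]

/-- If products lift boundedly through an injective map `J` from a Banach space, then so does the
multiplication map of the projective tensor square. -/
theorem exists_lift_multiplication {N W : Type*} [NormedAddCommGroup N] [NormedSpace 𝕜 N]
    [CompleteSpace N] [NormedAddCommGroup W] [NormedSpace 𝕜 W] (J : N →L[𝕜] W)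
    (hJ : Function.Injective J) (i : A →ₗ[𝕜] W) (hi : Continuous i) {C : ℝ}
    (h : ∀ a b, ∃ τ, J τ = i (a * b) ∧ ‖τ‖ ≤ C * ‖a‖ * ‖b‖)
    (u : ProjectiveTensorSquare 𝕜 A) : ∃ τ, J τ = i (multiplication 𝕜 A u) := by
  choose τ hτ hle using h
  -- The lifts are chosen arbitrarily; injectivity of `J` forces them to be bilinear.
  let φ : ContinuousMultilinearMap 𝕜 (fun _ : Fin 2 => A) N :=
    MultilinearMap.mkContinuous
      { toFun := fun m => τ (m 0) (m 1)
        map_update_add' := by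
          intro _ m i x y
          apply hJ
          rw [map_add, hτ, hτ, hτ]
          fin_cases i <;> simp [add_mul, mul_add]
        map_update_smul' := by
          intro _ m i c x
          apply hJ
          rw [map_smul, hτ, hτ]
          fin_cases i <;> simp [smul_mul_assoc, mul_smul_comm] }
      C (fun m => by
        rw [Fin.prod_univ_two, ← mul_assoc]
        exact hle _ _)
  let Φ : ProjectiveTensorSquare 𝕜 A →L[𝕜] N :=
    (PiTensorProduct.liftIsometry 𝕜 (fun _ : Fin 2 => A) _ φ).extend
      UniformSpace.Completion.toComplL
  have hΦ : ∀ t : ⨂[𝕜] _ : Fin 2, A,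
      Φ (t : ProjectiveTensorSquare 𝕜 A) = PiTensorProduct.lift φ.toMultilinearMap t := fun t =>
    (ContinuousLinearMap.extend_eq
      (PiTensorProduct.liftIsometry 𝕜 (fun _ : Fin 2 => A) _ φ)
      (e := (UniformSpace.Completion.toComplL :
        (⨂[𝕜] _ : Fin 2, A) →L[𝕜] UniformSpace.Completion (⨂[𝕜] _ : Fin 2, A)))
      UniformSpace.Completion.denseRange_coe
      (UniformSpace.Completion.isUniformInducing_coe _) t).trans
      (PiTensorProduct.liftIsometry_apply_apply φ t)
  refine ⟨Φ u, ?_⟩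
  induction u using UniformSpace.Completion.induction_on with
  | hp =>
    exact isClosed_eq (J.continuous.comp Φ.continuous)
      (hi.comp (multiplication 𝕜 A).continuous)
  | ih t =>
    induction t using PiTensorProduct.induction_on with
    | smul_tprod r m =>
      rw [UniformSpace.Completion.coe_smul, map_smul, map_smul, map_smul, map_smul,
        multiplication_tprod, hΦ, PiTensorProduct.lift.tprod]
      exact congrArg (r • ·) (hτ _ _)
    | add s t hs ht =>
      rw [UniformSpace.Completion.coe_add, map_add, map_add, map_add, map_add, hs, ht]

theorem exists_hasSum_multiplication (a b : ℕ → A) (h : Summable fun n => ‖a n‖ * ‖b n‖) :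
    ∃ u, HasSum (fun n => a n * b n) (multiplication 𝕜 A u) := by
  let w : ℕ → ProjectiveTensorSquare 𝕜 A :=
    fun n => ((PiTensorProduct.tprod 𝕜 ![a n, b n] : ⨂[𝕜] _ : Fin 2, A) :)
  have hw : Summable w := by
    refine Summable.of_norm_bounded h fun n => ?_
    rw [UniformSpace.Completion.norm_coe]
    refine (PiTensorProduct.projectiveSeminorm_tprod_le ![a n, b n]).trans_eq ?_
    simp [Fin.prod_univ_two]
  refine ⟨∑' n, w n, ?_⟩
  convert hw.hasSum.mapL (multiplication 𝕜 A) using 2 with n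
  exact (multiplication_tprod 𝕜 A ![a n, b n]).symm

end Multiplication

/-! ### The image of `μ` compared with the nuclear operators. -/

section MultiplicationRange

variable {𝕜 : Type*} [RCLike 𝕜]
variable {X : Type*} [NormedAddCommGroup X] [NormedSpace 𝕜 X] [CompleteSpace X]

theorem range_multiplication_subset_nuclearOperators {C : ℝ} (hC : 0 < C)
    (h : ∀ A ∈ finiteRank 𝕜 X, ∀ B ∈ finiteRank 𝕜 X,
      ‖finiteRankTrace (A * B)‖ ≤ C * ‖A‖ * ‖B‖) :
    Set.range (fun u => (multiplication 𝕜 (approximable 𝕜 X) u : X →L[𝕜] X)) ⊆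
      nuclearOperators 𝕜 X := by
  rintro _ ⟨u, rfl⟩
  obtain ⟨τ, hτ⟩ := exists_lift_multiplication (A := approximable 𝕜 X)
    (NuclearSpace.toOperator 𝕜 X) NuclearSpace.toOperator_injective
    (approximable 𝕜 X).toSubmodule.subtype continuous_subtype_val (C := 4 * C)
    (fun A B => exists_toOperator_eq_mul_of_approximable hC h A.2 B.2) u
  change IsNuclear ((approximable 𝕜 X).toSubmodule.subtype _)
  rw [← hτ]
  exact NuclearSpace.isNuclear_toOperator τ

theorem nuclearOperators_subset_range_multiplication :
    nuclearOperators 𝕜 X ⊆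
      Set.range (fun u => (multiplication 𝕜 (approximable 𝕜 X) u : X →L[𝕜] X)) := by
  rintro T ⟨f, y, hs, hT⟩
  -- The factorisation through `x₀` needs a unit vector, so `X = 0` is treated apart.
  rcases subsingleton_or_nontrivial X with hX | hX
  · exact ⟨0, Subsingleton.elim _ _⟩
  obtain ⟨v, hv⟩ := exists_ne (0 : X)
  obtain ⟨x₀, hx₀⟩ : ∃ x₀ : X, ‖x₀‖ = 1 :=
    ⟨((‖v‖⁻¹ : ℝ) : 𝕜) • v, by
      rw [norm_smul, RCLike.norm_ofReal, abs_inv, abs_norm, inv_mul_cancel₀ (norm_ne_zero_iff.2 hv)]⟩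
  obtain ⟨f₀, hf₀, hfx⟩ := exists_dual_vector' 𝕜 x₀
  have hmem : ∀ (f : StrongDual 𝕜 X) (y : X), f.smulRight y ∈ approximable 𝕜 X :=
    fun f y => finiteRank_le_approximable (smulRight_mem_finiteRank f y)
  have hnorm : ∀ n, ‖f₀.smulRight (y n)‖ * ‖(f n).smulRight x₀‖ = ‖f n‖ * ‖y n‖ := fun n => by
    rw [ContinuousLinearMap.norm_smulRight_apply, ContinuousLinearMap.norm_smulRight_apply,
      hf₀, hx₀]
    ring
  obtain ⟨u, hu⟩ := exists_hasSum_multiplication (𝕜 := 𝕜) (A := approximable 𝕜 X)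
    (fun n => ⟨f₀.smulRight (y n), hmem _ _⟩) (fun n => ⟨(f n).smulRight x₀, hmem _ _⟩)
    (hs.congr fun n => (hnorm n).symm)
  refine ⟨u, ?_⟩
  ext x
  have hsum := hu.map ((approximable 𝕜 X).toSubmodule.subtype.toAddMonoidHom)
    continuous_subtype_val
  refine (hsum.mapL (ContinuousLinearMap.apply 𝕜 X x)).unique ?_
  convert hT x using 2 with n
  -- The product of the two rank-one factors, where `f₀ x₀ = ‖x₀‖ = 1`.
  change f₀ (f n x • x₀) • y n = f n x • y n
  rw [map_smul, hfx, hx₀]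
  simp

end MultiplicationRange

end OperatorIdeals

end

theorem proposition2p8 {𝕜 : Type*} [RCLike 𝕜] (X : Type*) [NormedAddCommGroup X]
    [NormedSpace 𝕜 X] [CompleteSpace X] :
    -- (i) ⇒ (ii)
    ((OperatorIdeals.approximable 𝕜 X : Set (X →L[𝕜] X)) = OperatorIdeals.nuclearOperators 𝕜 X →
      (OperatorIdeals.approximable 𝕜 X : Set (X →L[𝕜] X)) ⊆
        OperatorIdeals.integralOperators 𝕜 X) ∧
    -- (ii) ⇔ (iii)
    ((OperatorIdeals.approximable 𝕜 X : Set (X →L[𝕜] X)) ⊆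
        OperatorIdeals.integralOperators 𝕜 X ↔
      ∃ C : ℝ, 0 < C ∧ ∀ A ∈ OperatorIdeals.finiteRank 𝕜 X, ∀ B ∈ OperatorIdeals.finiteRank 𝕜 X,
        ‖OperatorIdeals.finiteRankTrace (A * B)‖ ≤ C * ‖A‖ * ‖B‖) ∧
    -- (iii) ⇒ (iv)
    ((∃ C : ℝ, 0 < C ∧ ∀ A ∈ OperatorIdeals.finiteRank 𝕜 X, ∀ B ∈ OperatorIdeals.finiteRank 𝕜 X,
        ‖OperatorIdeals.finiteRankTrace (A * B)‖ ≤ C * ‖A‖ * ‖B‖) →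
      Set.range (fun u =>
          (OperatorIdeals.multiplication 𝕜 (OperatorIdeals.approximable 𝕜 X) u : X →L[𝕜] X)) =
        OperatorIdeals.nuclearOperators 𝕜 X) ∧
    -- if the multiplication is surjective, then (i), (ii), (iii), (iv) are equivalent
    (Function.Surjective
        (OperatorIdeals.multiplication 𝕜 (OperatorIdeals.approximable 𝕜 X)) →
      List.TFAE [
        (OperatorIdeals.approximable 𝕜 X : Set (X →L[𝕜] X)) =
          OperatorIdeals.nuclearOperators 𝕜 X,
        (OperatorIdeals.approximable 𝕜 X : Set (X →L[𝕜] X)) ⊆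
          OperatorIdeals.integralOperators 𝕜 X,
        ∃ C : ℝ, 0 < C ∧
          ∀ A ∈ OperatorIdeals.finiteRank 𝕜 X, ∀ B ∈ OperatorIdeals.finiteRank 𝕜 X,
            ‖OperatorIdeals.finiteRankTrace (A * B)‖ ≤ C * ‖A‖ * ‖B‖,
        Set.range (fun u =>
            (OperatorIdeals.multiplication 𝕜 (OperatorIdeals.approximable 𝕜 X) u : X →L[𝕜] X)) =
          OperatorIdeals.nuclearOperators 𝕜 X]) := by
  have h12 : (OperatorIdeals.approximable 𝕜 X : Set (X →L[𝕜] X)) =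
      OperatorIdeals.nuclearOperators 𝕜 X →
      (OperatorIdeals.approximable 𝕜 X : Set (X →L[𝕜] X)) ⊆
        OperatorIdeals.integralOperators 𝕜 X := by
    intro h T hT
    rw [h] at hT
    exact OperatorIdeals.IsNuclear.isIntegralOperator hT
  have h23 := OperatorIdeals.exists_bound_of_approximable_subset_integralOperators
    (𝕜 := 𝕜) (X := X)
  refine ⟨h12, ⟨h23, fun ⟨C, _, h⟩ =>
    OperatorIdeals.approximable_subset_integralOperators_of_bound h⟩, fun ⟨C, hC, h⟩ =>
    (OperatorIdeals.range_multiplication_subset_nuclearOperators hC h).antisymm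
      OperatorIdeals.nuclearOperators_subset_range_multiplication, fun hsurj => ?_⟩
  tfae_have 1 → 2 := h12
  tfae_have 2 → 3 := h23
  tfae_have 3 → 4 := fun ⟨C, hC, h⟩ =>
    (OperatorIdeals.range_multiplication_subset_nuclearOperators hC h).antisymm
      OperatorIdeals.nuclearOperators_subset_range_multiplication
  tfae_have 4 → 1 := by
    intro h
    rw [← h]
    ext T
    constructor
    · intro hT
      obtain ⟨u, hu⟩ := hsurj ⟨T, hT⟩
      exact ⟨u, congrArg Subtype.val hu⟩
    · rintro ⟨u, rfl⟩
      exact Subtype.property _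
  tfae_finish
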